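/- Let $K,A,B$ be finite nonempty sets, let $M_k\in\mathbb{R}^{A\times B}$ for $k\in K$, and let $Q_a\in\mathbb{R}^{K\times K}$ be a row-stochastic matrix for each $a\in A$. For a finite set $S$, $\Delta(S)$ denotes the set of probability distributions on $S$. Primal game. For an integer $N\ge 0$ and $p\in\Delta(K)$, the $N$-stage game $\Gamma_N(p)$ is played as follows. The state $k_1$ has law $p$, and for $t\ge 2$ the state $k_t$ has law $Q_{a_{t-1}}(k_{t-1},\cdot)$. Only player 1 observes the states. At each stage $t$ both players simultaneously choose actions $a_t\in A$, $b_t\in B$, which both then observe. A (behavior) strategy of player 1 is a family $\sigma=(\sigma_t)_{t\le N}$ with $\sigma_t:K^t\times A^{t-1}\times B^{t-1}\to\Delta(A)$, and one of player 2 is a family $\tau=(\tau_t)_{t\le N}$ with $\tau_t:A^{t-1}\times B^{t-1}\to\Delta(B)$. Player 1 maximizes, and player 2 minimizes, $\mathbf{E}_{p,\sigma,\tau}\left[\sum_{t=1}^N M_{k_t}(a_t,b_t)\right]$. Dual game. For $N\ge 1$ and $\alpha\in\mathbb{R}^K$, the $N$-stage dual game $G_N(\alpha)$ is played in the same way, except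 that player 1 also chooses the law $p\in\Delta(K)$ of the initial state (so player 1's strategies are the pairs $(p,\sigma)$, and player 2 does not observe $p$), and the payoff is $\mathbf{E}_{p,\sigma,\tau}\left[\alpha(k_1)+\sum_{t=1}^N M_{k_t}(a_t,b_t)\right]$. A game has a value if its $\max\min$ and its $\min\max$ over the two strategy sets exist (with all maxima and minima attained) and are equal; the value is this common number. For $\Pi\in\Delta(K\times A)$ and $a\in A$ put $\bar x(\Pi,a)=\sum_{k\in K}\Pi(k,a)$, and, if $\bar x(\Pi,a)>0$, $\phi_k(\Pi,a)=\Pi(k,a)/\bar x(\Pi,a)$ for $k\in K$. Proposition. For every integer $n\ge 0$ and every $\alpha\in\mathbb{R}^K$, the games $\Gamma_n(p)$, $p\in\Delta(K)$, have a value $v_n(p)$, the dual game $G_{n+1}(\alpha)$ has a value $w_{n+1}(\alpha)$, and $$w_{n+1}(\alpha)=\min_{\hat y\in\Delta(B)}\ \max_{\Pi\in\Delta(K\times A)}\left[\sum_{k\in K,\,a\in A}\Pi(k,a)\bigl(\alpha(k)+M_k(a,:)\hat y\bigr)+\sum_{a\in A}\bar x(\Pi,a)\,v_n\bigl(\phi(\Pi,a)^{T}Q_a\bigr)\right],$$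 where the minimum and the maxima are attained, and terms with $\bar x(\Pi,a)=0$ are read as $0$. -/

import Mathlib

open scoped Matrix

noncomputable section

/-- `c = max_x min_y f x y`, with every minimum and the maximum attained. -/
def IsMaxMin {X Y : Type*} (f : X → Y → ℝ) (c : ℝ) : Prop :=
  ∃ h : X → ℝ, (∀ x, IsLeast (Set.range fun y => f x y) (h x)) ∧ IsGreatest (Set.range h) c

/-- `c = min_y max_x f x y`, with every maximum and the minimum attained. -/
def IsMinMax {X Y : Type*} (f : X → Y → ℝ) (c : ℝ) : Prop :=
  ∃ h : Y → ℝ, (∀ y, IsGreatest (Set.range fun x => f x y) (h y)) ∧ IsLeast (Set.range h) c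

/-- `c` is the value of the zero-sum game with payoff `f x y`, where player 1 chooses `x` and
maximizes, and player 2 chooses `y` and minimizes: the maxmin and the minmax value both exist and
are equal to `c`. -/
def IsGameValue {X Y : Type*} (f : X → Y → ℝ) (c : ℝ) : Prop :=
  IsMaxMin f c ∧ IsMinMax f c

/-- The data of a stochastic game controlled by player 1: `M k` is the payoff matrix in state `k`,
and `Q a` is the (row-stochastic) transition matrix of the state under action `a` of player 1. -/
structure StochGame (K A B : Type*) [Fintype K] where
  M : K → Matrix A B ℝ
  Q : A → Matrix K K ℝ
  Q_mem : ∀ a k, Q a k ∈ stdSimplex ℝ K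

namespace StochGame

/-- Behavior strategies of the informed player in `N` stages. Stages are numbered from `0`: at
stage `t` the states of stages `0, …, t` and the actions of stages `0, …, t - 1` are known. -/
abbrev Strategy1 (K A B : Type*) [Fintype A] (N : ℕ) : Type _ :=
  (t : Fin N) → (Fin (t + 1) → K) → (Fin t → A) → (Fin t → B) → stdSimplex ℝ A

/-- Behavior strategies of the uninformed player in `N` stages: only the past actions are known. -/
abbrev Strategy2 (A B : Type*) [Fintype B] (N : ℕ) : Type _ :=
  (t : Fin N) → (Fin t → A) → (Fin t → B) → stdSimplex ℝ B

variable {K A B : Type*} [Fintype K]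

/-- The conditional probability, given the past, of the state at stage `t` of the play `ω`. -/
def stateProb (G : StochGame K A B) {N : ℕ} (p : K → ℝ) (ω : Fin N → K × A × B) : Fin N → ℝ
  | ⟨0, h⟩ => p (ω ⟨0, h⟩).1
  | ⟨s + 1, h⟩ =>
      G.Q (ω ⟨s, Nat.lt_of_succ_lt h⟩).2.1 (ω ⟨s, Nat.lt_of_succ_lt h⟩).1 (ω ⟨s + 1, h⟩).1

variable [Fintype A] [Fintype B]

/-- The probability of the play `ω ∈ (K × A × B)^N` if the initial state has law `p` and the
strategies `σ`, `τ` are played. -/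
def playProb (G : StochGame K A B) {N : ℕ} (p : K → ℝ) (σ : Strategy1 K A B N)
    (τ : Strategy2 A B N) (ω : Fin N → K × A × B) : ℝ :=
  ∏ t : Fin N, G.stateProb p ω t *
    (σ t (fun i => (ω (i.castLE t.isLt)).1) (fun i => (ω (i.castLE t.isLt.le)).2.1)
      (fun i => (ω (i.castLE t.isLt.le)).2.2)).1 (ω t).2.1 *
    (τ t (fun i => (ω (i.castLE t.isLt.le)).2.1)
      (fun i => (ω (i.castLE t.isLt.le)).2.2)).1 (ω t).2.2

/-- The total payoff `E (∑ₜ M_{kₜ}(aₜ, bₜ))` of the `N`-stage primal game. -/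
def primalPayoff (G : StochGame K A B) (N : ℕ) (p : K → ℝ) (σ : Strategy1 K A B N)
    (τ : Strategy2 A B N) : ℝ :=
  ∑ ω : Fin N → K × A × B, G.playProb p σ τ ω * ∑ t, G.M (ω t).1 (ω t).2.1 (ω t).2.2

/-- The total payoff `E (α(k₁) + ∑ₜ M_{kₜ}(aₜ, bₜ))` of the `N`-stage dual game, in which player 1
chooses the law of the initial state (`s.1`) and a behavior strategy (`s.2`). -/
def dualPayoff (G : StochGame K A B) (N : ℕ) [NeZero N] (α : K → ℝ)
    (s : stdSimplex ℝ K × Strategy1 K A B N) (τ : Strategy2 A B N) : ℝ :=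
  ∑ ω : Fin N → K × A × B, G.playProb s.1.1 s.2 τ ω *
    (α (ω 0).1 + ∑ t, G.M (ω t).1 (ω t).2.1 (ω t).2.2)

/-- The (maxmin) value `v_N(p)` of the `N`-stage primal game. -/
def primalValue (G : StochGame K A B) (N : ℕ) (p : K → ℝ) : ℝ :=
  ⨆ σ : Strategy1 K A B N, ⨅ τ : Strategy2 A B N, G.primalPayoff N p σ τ

/-- The (maxmin) value `w_N(α)` of the `N`-stage dual game. -/
def dualValue (G : StochGame K A B) (N : ℕ) [NeZero N] (α : K → ℝ) : ℝ :=
  ⨆ s : stdSimplex ℝ K × Strategy1 K A B N, ⨅ τ : Strategy2 A B N, G.dualPayoff N α s τ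

end StochGame

/-- `x̄(Π, a)`, the probability of the action `a` under the joint law `Π` of state and action. -/
def actionProb {K A : Type*} [Fintype K] (P : K × A → ℝ) (a : A) : ℝ := ∑ k, P (k, a)

/-- `φ(Π, a)`, the conditional law of the state given the action `a`
(the zero vector if `a` has probability `0`). -/
def posterior {K A : Type*} [Fintype K] (P : K × A → ℝ) (a : A) : K → ℝ :=
  fun k => P (k, a) / actionProb P a

end

set_option linter.unusedSectionVars false

/-! Fix a strategy `τ` of player 2 and record, for each initial state, the payoff `best n τ` of
player 1's best reply. Player 1 knows the state, so the best reply against a law `p` costs `p ⬝ᵥ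
best n τ`. Player 2 thus chooses a vector, and `minVal` is the minimum of a linear form over the
vectors available.

The vectors dominating some `best n τ` form a convex set (`convex_dominating_best`); cut by a box,
it is compact. So the first stage becomes a bilinear game: player 1 picks a joint law `P` of state
and action, player 2 picks `y` and one such vector `h a` per action. Sion's theorem gives a saddle
point (`exists_saddle`). Player 2 turns it into `cons2 y₀ τ₀`. Player 1 disintegrates `P₀` and then
plays optimally for the law of the next state given the action (`exists_guarantee_succ`).

If the state marginal of `P` is fixed to be `p`, induction on the number of stages shows that
`minVal` is the primal value. If it is free, the same saddle point solves the dual game. Minimizing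
over the `h a` separately leaves the one-stage formula, once homogeneity of `minVal` absorbs the
normalization of posteriors. -/

/-- A saddle point of a separately continuous game on compact strategy spaces gives its value. -/
theorem isGameValue_of_saddle {X Y : Type*} [TopologicalSpace X] [CompactSpace X]
    [TopologicalSpace Y] [CompactSpace Y] {f : X → Y → ℝ} {c : ℝ} {x₀ : X} {y₀ : Y}
    (hfx : ∀ y, Continuous fun x => f x y) (hfy : ∀ x, Continuous (f x))
    (hx : ∀ x, f x y₀ ≤ c) (hy : ∀ y, c ≤ f x₀ y) : IsGameValue f c := by
  have : Nonempty X := ⟨x₀⟩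
  have : Nonempty Y := ⟨y₀⟩
  have hmin : ∀ x, IsLeast (Set.range fun y => f x y) (sInf (Set.range fun y => f x y)) :=
    fun x => (isCompact_range (hfy x)).isLeast_sInf (Set.range_nonempty _)
  have hmax : ∀ y, IsGreatest (Set.range fun x => f x y) (sSup (Set.range fun x => f x y)) :=
    fun y => (isCompact_range (hfx y)).isGreatest_sSup (Set.range_nonempty _)
  refine ⟨⟨_, hmin, ⟨x₀, le_antisymm ?_ ?_⟩, ?_⟩, ⟨_, hmax, ⟨y₀, le_antisymm ?_ ?_⟩, ?_⟩⟩
  · exact ((hmin x₀).2 ⟨y₀, rfl⟩).trans (hx x₀)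
  · obtain ⟨y, h⟩ := (hmin x₀).1
    exact (hy y).trans h.le
  · rintro _ ⟨x, rfl⟩
    exact ((hmin x).2 ⟨y₀, rfl⟩).trans (hx x)
  · obtain ⟨x, h⟩ := (hmax y₀).1
    exact h.ge.trans (hx x)
  · exact (hy y₀).trans ((hmax y₀).2 ⟨x₀, rfl⟩)
  · rintro _ ⟨y, rfl⟩
    exact (hy y).trans ((hmax y).2 ⟨x₀, rfl⟩)

theorem IsMaxMin.eq_iSup_iInf {X Y : Type*} {f : X → Y → ℝ} {c : ℝ} (h : IsMaxMin f c) :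
    ⨆ x, ⨅ y, f x y = c := by
  obtain ⟨g, hg, hc⟩ := h
  have : (fun x => ⨅ y, f x y) = g := funext fun x => (hg x).csInf_eq
  rw [this]
  exact hc.csSup_eq

instance stdSimplex.nonempty_real {S : Type*} [Fintype S] [Nonempty S] :
    Nonempty (stdSimplex ℝ S) := by
  classical
  exact ⟨⟨_, single_mem_stdSimplex ℝ (Classical.arbitrary S)⟩⟩

namespace StochGame

variable {K A B : Type*} [Fintype K] [Fintype A] [Fintype B] {n : ℕ}

/-! ### Splitting strategies and payoffs at the first stage -/

/-- The first-stage mixed action of a strategy of the uninformed player. -/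
def head2 (τ : Strategy2 A B (n + 1)) : stdSimplex ℝ B := τ 0 Fin.elim0 Fin.elim0

/-- The continuation of a strategy of the uninformed player after the actions `a`, `b`. -/
def tail2 (τ : Strategy2 A B (n + 1)) (a : A) (b : B) : Strategy2 A B n :=
  fun t as bs => τ t.succ (Fin.cons (α := fun _ => A) a as) (Fin.cons (α := fun _ => B) b bs)

/-- The strategy playing `y` first and continuing with `τ a` after the action `a` of player 1. -/
def cons2 (y : stdSimplex ℝ B) (τ : A → Strategy2 A B n) : Strategy2 A B (n + 1) :=
  Fin.cases (fun _ _ => y)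
    (fun t (as : Fin (t + 1) → A) (bs : Fin (t + 1) → B) => τ (as 0) t (Fin.tail as) (Fin.tail bs))

@[simp] theorem head2_cons2 (y : stdSimplex ℝ B) (τ : A → Strategy2 A B n) :
    head2 (cons2 y τ) = y := rfl

@[simp] theorem tail2_cons2 (y : stdSimplex ℝ B) (τ : A → Strategy2 A B n) (a : A) (b : B) :
    tail2 (cons2 y τ) a b = τ a := rfl


/-- The first-stage mixed action of a strategy of the informed player in the state `k`. -/
def head1 (σ : Strategy1 K A B (n + 1)) (k : K) : stdSimplex ℝ A :=
  σ 0 (fun _ => k) Fin.elim0 Fin.elim0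

/-- The continuation of a strategy of the informed player after the state `k` and the actions
`a`, `b`. -/
def tail1 (σ : Strategy1 K A B (n + 1)) (k : K) (a : A) (b : B) : Strategy1 K A B n :=
  fun t ks as bs => σ t.succ (Fin.cons (α := fun _ => K) k ks) (Fin.cons (α := fun _ => A) a as)
    (Fin.cons (α := fun _ => B) b bs)

/-- The strategy playing `x k` first and continuing with `σ a` after the action `a`, irrespective
of the first state and of the first action of player 2. -/
def cons1 (x : K → stdSimplex ℝ A) (σ : A → Strategy1 K A B n) : Strategy1 K A B (n + 1) :=
  Fin.cases (fun ks _ _ => x (ks 0))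
    (fun t (ks : Fin (t + 1 + 1) → K) (as : Fin (t + 1) → A) (bs : Fin (t + 1) → B) =>
      σ (as 0) t (Fin.tail ks) (Fin.tail as) (Fin.tail bs))

@[simp] theorem head1_cons1 (x : K → stdSimplex ℝ A) (σ : A → Strategy1 K A B n) :
    head1 (cons1 x σ) = x := rfl

@[simp] theorem tail1_cons1 (x : K → stdSimplex ℝ A) (σ : A → Strategy1 K A B n) (k : K) (a : A)
    (b : B) : tail1 (cons1 x σ) k a b = σ a := rfl

/-- The transition depends only on the state and player 1's action, so after `(k, a, b)` the play is
one of the shorter game with initial law `G.Q a k`. -/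
theorem playProb_cons (G : StochGame K A B) (p : K → ℝ) (σ : Strategy1 K A B (n + 1))
    (τ : Strategy2 A B (n + 1)) (k : K) (a : A) (b : B) (ω : Fin n → K × A × B) :
    G.playProb p σ τ (Fin.cons (α := fun _ => K × A × B) (k, a, b) ω) =
      p k * (head1 σ k).1 a * (head2 τ).1 b *
        G.playProb (G.Q a k) (tail1 σ k a b) (tail2 τ a b) ω := by
  unfold playProb
  rw [Fin.prod_univ_succ]
  refine congrArg₂ _ (congrArg₂ _ (congrArg₂ _ rfl ?_) ?_) (Finset.prod_congr rfl fun t _ =>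
    congrArg₂ _ (congrArg₂ _ ?_ ?_) ?_)
  · refine congrArg (fun z : stdSimplex ℝ A => z.1 a)
      (congr (congr (congrArg (σ 0) (funext fun i => ?_)) (funext fun i => i.elim0))
        (funext fun i => i.elim0))
    obtain rfl : i = ⟨0, Nat.one_pos⟩ := Fin.ext (Nat.lt_one_iff.1 i.2)
    rfl
  · exact congrArg (fun z : stdSimplex ℝ B => z.1 b)
      (congr (congrArg (τ 0) (funext fun i => i.elim0)) (funext fun i => i.elim0))
  -- At `t = 0` the initial law of the continuation is the old transition law; later factors are
  -- unchanged.
  · obtain ⟨t, ht⟩ := t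
    cases t <;> rfl
  · exact congrArg (fun z : stdSimplex ℝ A => z.1 (ω t).2.1)
      (congr (congr (congrArg (σ t.succ) (funext fun i => Fin.cases rfl (fun i => rfl) i))
        (funext fun i => Fin.cases rfl (fun i => rfl) i))
        (funext fun i => Fin.cases rfl (fun i => rfl) i))
  · exact congrArg (fun z : stdSimplex ℝ B => z.1 (ω t).2.2)
      (congr (congrArg (τ t.succ) (funext fun i => Fin.cases rfl (fun i => rfl) i))
        (funext fun i => Fin.cases rfl (fun i => rfl) i))

theorem sum_plays_succ (f : (Fin (n + 1) → K × A × B) → ℝ) :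
    ∑ ω, f ω = ∑ k, ∑ a, ∑ b, ∑ ω : Fin n → K × A × B,
      f (Fin.cons (α := fun _ => K × A × B) (k, a, b) ω) := by
  rw [← (Fin.consEquiv fun _ => K × A × B).sum_comp, Fintype.sum_prod_type, Fintype.sum_prod_type]
  refine Finset.sum_congr rfl fun k _ => ?_
  rw [Fintype.sum_prod_type]
  rfl

theorem sum_playProb (G : StochGame K A B) {p : K → ℝ} (hp : p ∈ stdSimplex ℝ K)
    (σ : Strategy1 K A B n) (τ : Strategy2 A B n) : ∑ ω, G.playProb p σ τ ω = 1 := by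
  induction n generalizing p with
  | zero => simp [playProb]
  | succ n ih =>
    rw [sum_plays_succ]
    simp_rw [playProb_cons, ← Finset.mul_sum, ih (G.Q_mem _ _), mul_one, ← Finset.mul_sum,
      (head2 τ).2.2, mul_one, ← Finset.mul_sum, (head1 σ _).2.2, mul_one]
    exact hp.2

theorem primalPayoff_zero (G : StochGame K A B) (p : K → ℝ) (σ : Strategy1 K A B 0)
    (τ : Strategy2 A B 0) : G.primalPayoff 0 p σ τ = 0 := by
  simp [primalPayoff]

theorem primalPayoff_succ (G : StochGame K A B) (p : K → ℝ) (σ : Strategy1 K A B (n + 1))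
    (τ : Strategy2 A B (n + 1)) :
    G.primalPayoff (n + 1) p σ τ = ∑ k, p k * ∑ a, (head1 σ k).1 a * ∑ b, (head2 τ).1 b *
      (G.M k a b + G.primalPayoff n (G.Q a k) (tail1 σ k a b) (tail2 τ a b)) := by
  unfold primalPayoff
  rw [sum_plays_succ]
  refine Finset.sum_congr rfl fun k _ => ?_
  rw [Finset.mul_sum]
  refine Finset.sum_congr rfl fun a _ => ?_
  rw [Finset.mul_sum, Finset.mul_sum]
  refine Finset.sum_congr rfl fun b _ => ?_
  simp_rw [playProb_cons, Fin.sum_univ_succ, Fin.cons_zero, Fin.cons_succ, mul_assoc,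
    ← Finset.mul_sum]
  congr 3
  simp_rw [mul_add, Finset.sum_add_distrib]
  rw [← Finset.sum_mul, sum_playProb G (G.Q_mem _ _), one_mul]

theorem sum_playProb_mul_initial (G : StochGame K A B) (α : K → ℝ) (p : K → ℝ)
    (σ : Strategy1 K A B (n + 1)) (τ : Strategy2 A B (n + 1)) :
    ∑ ω, G.playProb p σ τ ω * α (ω 0).1 = p ⬝ᵥ α := by
  rw [sum_plays_succ]
  simp_rw [playProb_cons, Fin.cons_zero, ← Finset.sum_mul, ← Finset.mul_sum,
    sum_playProb G (G.Q_mem _ _), mul_one, ← Finset.mul_sum, (head2 τ).2.2, mul_one,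
    ← Finset.mul_sum, (head1 σ _).2.2, mul_one]
  rfl

theorem dualPayoff_eq (G : StochGame K A B) (α : K → ℝ)
    (s : stdSimplex ℝ K × Strategy1 K A B (n + 1)) (τ : Strategy2 A B (n + 1)) :
    G.dualPayoff (n + 1) α s τ = s.1.1 ⬝ᵥ α + G.primalPayoff (n + 1) s.1.1 s.2 τ := by
  unfold dualPayoff primalPayoff
  simp_rw [mul_add, Finset.sum_add_distrib]
  rw [sum_playProb_mul_initial]

theorem primalPayoff_smul (G : StochGame K A B) (c : ℝ) (p : K → ℝ) (σ : Strategy1 K A B n)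
    (τ : Strategy2 A B n) : G.primalPayoff n (c • p) σ τ = c * G.primalPayoff n p σ τ := by
  cases n with
  | zero => simp [primalPayoff_zero]
  | succ n => simp [primalPayoff_succ, Finset.mul_sum, mul_assoc]

/-- For fixed strategies the payoff is linear in the initial law; this merges the continuations
after different first states. -/
theorem primalPayoff_vecMul (G : StochGame K A B) (q : K → ℝ) (P : Matrix K K ℝ)
    (σ : Strategy1 K A B n) (τ : Strategy2 A B n) :
    G.primalPayoff n (q ᵥ* P) σ τ = ∑ k, q k * G.primalPayoff n (P k) σ τ := by
  cases n with
  | zero => simp [primalPayoff_zero]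
  | succ n =>
    simp only [primalPayoff_succ, Matrix.vecMul, dotProduct, Finset.sum_mul]
    rw [Finset.sum_comm]
    simp_rw [mul_assoc, Finset.mul_sum]

/-! ### Continuity of the payoffs -/

theorem continuous_playProb (G : StochGame K A B) {X : Type*} [TopologicalSpace X] {p : X → K → ℝ}
    {σ : X → Strategy1 K A B n} {τ : X → Strategy2 A B n} (hp : Continuous p) (hσ : Continuous σ)
    (hτ : Continuous τ) (ω : Fin n → K × A × B) :
    Continuous fun x => G.playProb (p x) (σ x) (τ x) ω := by
  unfold playProb
  refine continuous_finsetProd _ fun t _ => ?_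
  refine (Continuous.mul ?_ ?_).mul ?_
  · obtain ⟨t, ht⟩ := t
    cases t with
    | zero => exact (continuous_apply _).comp hp
    | succ s => exact continuous_const
  · exact (continuous_apply _).comp (continuous_subtype_val.comp (by fun_prop))
  · exact (continuous_apply _).comp (continuous_subtype_val.comp (by fun_prop))

theorem continuous_primalPayoff (G : StochGame K A B) {X : Type*} [TopologicalSpace X]
    {p : X → K → ℝ} {σ : X → Strategy1 K A B n} {τ : X → Strategy2 A B n} (hp : Continuous p)
    (hσ : Continuous σ) (hτ : Continuous τ) :
    Continuous fun x => G.primalPayoff n (p x) (σ x) (τ x) :=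
  continuous_finsetSum _ fun ω _ => (G.continuous_playProb hp hσ hτ ω).mul continuous_const

theorem continuous_dualPayoff (G : StochGame K A B) (α : K → ℝ) {X : Type*} [TopologicalSpace X]
    {s : X → stdSimplex ℝ K × Strategy1 K A B (n + 1)} {τ : X → Strategy2 A B (n + 1)}
    (hs : Continuous s) (hτ : Continuous τ) :
    Continuous fun x => G.dualPayoff (n + 1) α (s x) (τ x) :=
  continuous_finsetSum _ fun ω _ => (G.continuous_playProb
    (continuous_subtype_val.comp hs.fst) hs.snd hτ ω).mul continuous_const

/-! ### Best-reply vectors of player 2's strategies -/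

/-- The payoff of a best reply of player 1 to `τ`, as a function of the initial state. -/
noncomputable def best [Nonempty A] (G : StochGame K A B) :
    (n : ℕ) → Strategy2 A B n → K → ℝ
  | 0, _, _ => 0
  | n + 1, τ, k => Finset.univ.sup' Finset.univ_nonempty fun a =>
      ∑ b, (head2 τ).1 b * (G.M k a b + G.Q a k ⬝ᵥ best G n (tail2 τ a b))

/-- The least payoff that player 2 can guarantee, extended to all vectors `q`. -/
noncomputable def minVal [Nonempty A] (G : StochGame K A B) (n : ℕ) (q : K → ℝ) : ℝ :=
  ⨅ τ : Strategy2 A B n, q ⬝ᵥ G.best n τ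

variable [Nonempty A]

theorem le_best_succ (G : StochGame K A B) (τ : Strategy2 A B (n + 1)) (k : K) (a : A) :
    ∑ b, (head2 τ).1 b * (G.M k a b + G.Q a k ⬝ᵥ G.best n (tail2 τ a b)) ≤
      G.best (n + 1) τ k :=
  Finset.le_sup' (fun a => ∑ b, (head2 τ).1 b *
    (G.M k a b + G.Q a k ⬝ᵥ G.best n (tail2 τ a b))) (Finset.mem_univ a)

/-- A mixed action never beats the best pure one; backward induction applies this at every stage. -/
theorem primalPayoff_le_best (G : StochGame K A B) {p : K → ℝ} (hp : 0 ≤ p)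
    (σ : Strategy1 K A B n) (τ : Strategy2 A B n) :
    G.primalPayoff n p σ τ ≤ p ⬝ᵥ G.best n τ := by
  induction n generalizing p with
  | zero => simp [primalPayoff_zero, best, dotProduct]
  | succ n ih =>
    rw [primalPayoff_succ]
    refine Finset.sum_le_sum fun k _ => mul_le_mul_of_nonneg_left ?_ (hp k)
    calc _ ≤ ∑ a, (head1 σ k).1 a * G.best (n + 1) τ k := by
          refine Finset.sum_le_sum fun a _ =>
            mul_le_mul_of_nonneg_left (le_trans ?_ (G.le_best_succ τ k a)) ((head1 σ k).2.1 a)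
          refine Finset.sum_le_sum fun b _ =>
            mul_le_mul_of_nonneg_left ?_ ((head2 τ).2.1 b)
          gcongr
          exact ih (G.Q_mem a k).1 _ _
      _ = _ := by rw [← Finset.sum_mul, (head1 σ k).2.2, one_mul]

theorem continuous_best (G : StochGame K A B) : Continuous (G.best n) := by
  induction n with
  | zero => exact continuous_const
  | succ n ih =>
    refine continuous_pi fun k => ?_
    refine Continuous.finset_sup'_apply _ fun a _ => continuous_finsetSum _ fun b _ => ?_
    refine Continuous.mul ?_ (continuous_const.add ?_)
    · exact (continuous_apply _).comp (continuous_subtype_val.comp (by unfold head2; fun_prop))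
    · refine Continuous.dotProduct continuous_const (ih.comp ?_)
      unfold tail2
      fun_prop

theorem best_cons2 (G : StochGame K A B) (y : stdSimplex ℝ B) (τ : A → Strategy2 A B n) (k : K) :
    G.best (n + 1) (cons2 y τ) k = Finset.univ.sup' Finset.univ_nonempty fun a =>
      G.M k a ⬝ᵥ y.1 + G.Q a k ⬝ᵥ G.best n (τ a) := by
  simp only [best, head2_cons2, tail2_cons2, mul_add, Finset.sum_add_distrib, ← Finset.sum_mul,
    y.2.2, one_mul]
  simp only [dotProduct, mul_comm]

/-- The vector payoffs that player 2 can guarantee form a convex set. -/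
theorem convex_dominating_best (G : StochGame K A B) :
    Convex ℝ {h : K → ℝ | ∃ τ : Strategy2 A B n, G.best n τ ≤ h} := by
  induction n with
  | zero =>
    rintro x ⟨τ, hx⟩ y ⟨_, hy⟩ a b ha hb -
    exact ⟨τ, add_nonneg (smul_nonneg ha hx) (smul_nonneg hb hy)⟩
  | succ n ih =>
    rintro h₁ ⟨τ₁, hh₁⟩ h₂ ⟨τ₂, hh₂⟩ s t hs ht hst
    -- Averaging over `b` by convexity yields a continuation that depends on player 1's action
    -- alone, as `cons2` requires.
    have key : ∀ (τ : Strategy2 A B (n + 1)) (a : A),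
        ∃ τ' : Strategy2 A B n, G.best n τ' ≤ ∑ b, (head2 τ).1 b • G.best n (tail2 τ a b) :=
      fun τ a => ih.sum_mem (fun b _ => (head2 τ).2.1 b) (head2 τ).2.2
        (fun b _ => ⟨tail2 τ a b, le_rfl⟩)
    have hmix : ∀ a, ∃ τ' : Strategy2 A B n, G.best n τ' ≤
        s • (∑ b, (head2 τ₁).1 b • G.best n (tail2 τ₁ a b)) +
          t • ∑ b, (head2 τ₂).1 b • G.best n (tail2 τ₂ a b) :=
      fun a => ih (key τ₁ a) (key τ₂ a) hs ht hst
    choose τ hτ using hmix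
    refine ⟨cons2 ⟨_, convex_stdSimplex ℝ B (head2 τ₁).2 (head2 τ₂).2 hs ht hst⟩ τ, fun k => ?_⟩
    rw [best_cons2]
    refine Finset.sup'_le _ _ fun a _ => ?_
    have h1 := mul_le_mul_of_nonneg_left ((G.le_best_succ τ₁ k a).trans (hh₁ k)) hs
    have h2 := mul_le_mul_of_nonneg_left ((G.le_best_succ τ₂ k a).trans (hh₂ k)) ht
    have h3 := dotProduct_le_dotProduct_of_nonneg_left (hτ a) (G.Q_mem a k).1
    have e : ∀ τ : Strategy2 A B (n + 1),
        ∑ b, (head2 τ).1 b * (G.M k a b + G.Q a k ⬝ᵥ G.best n (tail2 τ a b)) =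
        G.M k a ⬝ᵥ (head2 τ).1 + G.Q a k ⬝ᵥ ∑ b, (head2 τ).1 b • G.best n (tail2 τ a b) := by
      intro τ
      simp only [mul_add, Finset.sum_add_distrib, dotProduct_sum, dotProduct_smul, smul_eq_mul]
      simp only [dotProduct, mul_comm]
    rw [e] at h1 h2
    simp only [dotProduct_add, dotProduct_smul, smul_eq_mul, Pi.add_apply, Pi.smul_apply] at h3 ⊢
    linarith

/-- A compact convex set containing all best-reply payoffs against strategies of player 2, and
whose elements can all be guaranteed by player 2. -/
theorem exists_compact_convex_best (G : StochGame K A B) [Nonempty B] (n : ℕ) :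
    ∃ E : Set (K → ℝ), IsCompact E ∧ Convex ℝ E ∧ (∀ τ : Strategy2 A B n, G.best n τ ∈ E) ∧
      ∀ h ∈ E, ∃ τ : Strategy2 A B n, G.best n τ ≤ h := by
  have hc : IsCompact (Set.range (G.best n)) := isCompact_range G.continuous_best
  obtain ⟨u, hu⟩ := hc.isBounded.bddAbove
  obtain ⟨l, hl⟩ := hc.isBounded.bddBelow
  -- The set is the projection of a closed set along the compact strategy space.
  have hcl : IsClosed {h : K → ℝ | ∃ τ : Strategy2 A B n, G.best n τ ≤ h} := by
    have : IsClosed {z : (K → ℝ) × Strategy2 A B n | G.best n z.2 ≤ z.1} :=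
      isClosed_le (G.continuous_best.comp continuous_snd) continuous_fst
    convert isClosedMap_fst_of_compactSpace _ this
    ext h
    simp
  refine ⟨{h | ∃ τ : Strategy2 A B n, G.best n τ ≤ h} ∩ Set.Icc l u,
    isCompact_Icc.inter_left hcl, G.convex_dominating_best.inter (convex_Icc _ _),
    fun τ => ⟨⟨τ, le_rfl⟩, hl ⟨τ, rfl⟩, hu ⟨τ, rfl⟩⟩, fun h hh => hh.1⟩

variable [Nonempty B]

theorem exists_minVal_eq (G : StochGame K A B) (n : ℕ) (q : K → ℝ) :
    ∃ τ : Strategy2 A B n, q ⬝ᵥ G.best n τ = G.minVal n q :=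
  (isCompact_range (Continuous.dotProduct continuous_const G.continuous_best)).sInf_mem
    (Set.range_nonempty _)

theorem minVal_le (G : StochGame K A B) (q : K → ℝ) (τ : Strategy2 A B n) :
    G.minVal n q ≤ q ⬝ᵥ G.best n τ :=
  ((isCompact_range (Continuous.dotProduct continuous_const G.continuous_best)).isLeast_sInf
    (Set.range_nonempty _)).2 ⟨τ, rfl⟩

theorem minVal_smul (G : StochGame K A B) {c : ℝ} (hc : 0 ≤ c) (q : K → ℝ) :
    G.minVal n (c • q) = c * G.minVal n q := by
  simp only [minVal, Real.mul_iInf_of_nonneg hc, smul_dotProduct, smul_eq_mul]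

/-! ### The one-stage game and its saddle point -/

/-- The payoff of the one-stage game with joint law `P` of state and action, mixed action `y`, and
continuation payoff `h a` after the action `a`. -/
def stagePayoff (G : StochGame K A B) (β : K → ℝ) (P : K × A → ℝ) (y : B → ℝ)
    (h : A → K → ℝ) : ℝ :=
  ∑ k, ∑ a, P (k, a) * (β k + G.M k a ⬝ᵥ y + G.Q a k ⬝ᵥ h a)

/-- The payoff of the one-stage game with optimal continuation. -/
noncomputable def stageValue (G : StochGame K A B) (n : ℕ) (β : K → ℝ)
    (P : K × A → ℝ) (y : B → ℝ) : ℝ :=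
  (∑ k, ∑ a, P (k, a) * (β k + G.M k a ⬝ᵥ y)) +
    ∑ a, G.minVal n ((fun k => P (k, a)) ᵥ* G.Q a)

/-- Each `h a` meets only the unnormalized next-state law after `a`, so the continuations can be
minimized separately for each action. -/
theorem stagePayoff_eq (G : StochGame K A B) (β : K → ℝ) (P : K × A → ℝ) (y : B → ℝ)
    (h : A → K → ℝ) : G.stagePayoff β P y h =
      (∑ k, ∑ a, P (k, a) * (β k + G.M k a ⬝ᵥ y)) +
        ∑ a, ((fun k => P (k, a)) ᵥ* G.Q a) ⬝ᵥ h a := by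
  have : ∀ a, ((fun k => P (k, a)) ᵥ* G.Q a) ⬝ᵥ h a = ∑ k, P (k, a) * (G.Q a k ⬝ᵥ h a) := by
    intro a
    rw [← Matrix.dotProduct_mulVec]
    rfl
  simp_rw [this, stagePayoff, mul_add, Finset.sum_add_distrib]
  congr 1
  exact Finset.sum_comm

theorem stagePayoff_eq_add (G : StochGame K A B) (β : K → ℝ) (P : K × A → ℝ) (y : B → ℝ)
    (h : A → K → ℝ) : G.stagePayoff β P y h =
      (fun k => ∑ a, P (k, a)) ⬝ᵥ β + G.stagePayoff 0 P y h := by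
  simp_rw [stagePayoff, dotProduct, Finset.sum_mul, ← Finset.sum_add_distrib, Pi.zero_apply]
  refine Finset.sum_congr rfl fun k _ => Finset.sum_congr rfl fun a _ => ?_
  ring

theorem stageValue_le (G : StochGame K A B) (β : K → ℝ) (P : K × A → ℝ) (y : B → ℝ)
    (τ : A → Strategy2 A B n) :
    G.stageValue n β P y ≤ G.stagePayoff β P y fun a => G.best n (τ a) := by
  rw [stagePayoff_eq]
  exact add_le_add_right (Finset.sum_le_sum fun a _ => G.minVal_le _ _) _

theorem exists_stageValue_eq (G : StochGame K A B) (n : ℕ) (β : K → ℝ) (P : K × A → ℝ)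
    (y : B → ℝ) : ∃ τ : A → Strategy2 A B n,
      (G.stagePayoff β P y fun a => G.best n (τ a)) = G.stageValue n β P y := by
  choose τ hτ using fun a => G.exists_minVal_eq n ((fun k => P (k, a)) ᵥ* G.Q a)
  refine ⟨τ, ?_⟩
  rw [stagePayoff_eq]
  exact congrArg _ (Finset.sum_congr rfl fun a _ => hτ a)

theorem stageValue_eq_add (G : StochGame K A B) (β : K → ℝ) (P : K × A → ℝ) (y : B → ℝ) :
    G.stageValue n β P y = (fun k => ∑ a, P (k, a)) ⬝ᵥ β + G.stageValue n 0 P y := by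
  simp_rw [stageValue, dotProduct, Finset.sum_mul, ← add_assoc, ← Finset.sum_add_distrib,
    Pi.zero_apply]
  congr 1
  refine Finset.sum_congr rfl fun k _ => Finset.sum_congr rfl fun a _ => ?_
  ring

theorem stagePayoff_mono (G : StochGame K A B) (β : K → ℝ) {P : K × A → ℝ} (hP : ∀ i, 0 ≤ P i)
    (y : B → ℝ) {h h' : A → K → ℝ} (hh : ∀ a, h a ≤ h' a) :
    G.stagePayoff β P y h ≤ G.stagePayoff β P y h' :=
  Finset.sum_le_sum fun k _ => Finset.sum_le_sum fun a _ =>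
    mul_le_mul_of_nonneg_left
      (add_le_add_right (dotProduct_le_dotProduct_of_nonneg_left (hh a) (G.Q_mem a k).1) _) (hP _)

/-- The one-stage game with continuation payoffs guaranteed by player 2 has a saddle point. -/
theorem exists_saddle (G : StochGame K A B) (n : ℕ) (β : K → ℝ) {X : Set (K × A → ℝ)}
    {Y : Set (B → ℝ)} (hX : X ⊆ stdSimplex ℝ (K × A)) (cX : Convex ℝ X) (kX : IsCompact X)
    (neX : X.Nonempty) (cY : Convex ℝ Y) (kY : IsCompact Y) (neY : Y.Nonempty) :
    ∃ P₀ ∈ X, ∃ y₀ ∈ Y, ∃ τ₀ : A → Strategy2 A B n, ∃ c,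
      (∀ P ∈ X, (G.stagePayoff β P y₀ fun a => G.best n (τ₀ a)) ≤ c) ∧
      ∀ y ∈ Y, c ≤ G.stageValue n β P₀ y := by
  obtain ⟨E, kE, cE, hE, hE'⟩ := G.exists_compact_convex_best n
  have affine_right : ∀ (P : K × A → ℝ) (z z' : (B → ℝ) × (A → K → ℝ)) (s t : ℝ), s + t = 1 →
      G.stagePayoff β P (s • z + t • z').1 (s • z + t • z').2 =
        s * G.stagePayoff β P z.1 z.2 + t * G.stagePayoff β P z'.1 z'.2 := by
    intro P z z' s t hst
    simp_rw [stagePayoff, Finset.mul_sum, ← Finset.sum_add_distrib]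
    refine Finset.sum_congr rfl fun k _ => Finset.sum_congr rfl fun a _ => ?_
    simp only [Prod.fst_add, Prod.snd_add, Prod.smul_fst, Prod.smul_snd, dotProduct_add,
      dotProduct_smul, smul_eq_mul, Pi.add_apply, Pi.smul_apply]
    -- The `β` term does not involve `(y, h)`, so `s + t = 1` is needed here.
    linear_combination (-P (k, a) * β k) * hst
  have affine_left : ∀ (P P' : K × A → ℝ) (y : B → ℝ) (h : A → K → ℝ) (s t : ℝ),
      G.stagePayoff β (s • P + t • P') y h =
        s * G.stagePayoff β P y h + t * G.stagePayoff β P' y h := by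
    intro P P' y h s t
    simp_rw [stagePayoff, Finset.mul_sum, ← Finset.sum_add_distrib]
    refine Finset.sum_congr rfl fun k _ => Finset.sum_congr rfl fun a _ => ?_
    simp only [smul_eq_mul, Pi.add_apply, Pi.smul_apply]
    ring
  have cE' : Convex ℝ (Set.univ.pi fun _ : A => E) := convex_pi fun _ _ => cE
  obtain ⟨⟨y₀, h₀⟩, ⟨hy₀, hh₀⟩, P₀, hP₀, hs⟩ := Sion.exists_isSaddlePointOn
    (X := Y ×ˢ Set.univ.pi fun _ : A => E) (Y := X)
    (f := fun z P => G.stagePayoff β P z.1 z.2)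
    (neY.prod (Set.univ_pi_nonempty_iff.2 fun _ => ⟨_, hE (Classical.arbitrary _)⟩))
    (cY.prod cE') (kY.prod (isCompact_univ_pi fun _ => kE))
    (fun P _ => (Continuous.lowerSemicontinuous (by
      unfold stagePayoff dotProduct; fun_prop)).lowerSemicontinuousOn _)
    (fun P _ => ConvexOn.quasiconvexOn ⟨cY.prod cE', fun z _ z' _ s t _ _ hst =>
      (affine_right P z z' s t hst).le⟩)
    cX neX kX
    (fun z _ => (Continuous.upperSemicontinuous (by
      unfold stagePayoff; fun_prop)).upperSemicontinuousOn _)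
    (fun z _ => ConcaveOn.quasiconcaveOn ⟨cX, fun P _ P' _ s t _ _ _ =>
      (affine_left P P' z.1 z.2 s t).ge⟩)
  choose τ₀ hτ₀ using fun a => hE' (h₀ a) (hh₀ a (Set.mem_univ a))
  refine ⟨P₀, hP₀, y₀, hy₀, τ₀, G.stagePayoff β P₀ y₀ h₀, fun P hP => ?_, fun y hy => ?_⟩
  · exact (G.stagePayoff_mono β (hX hP).1 y₀ hτ₀).trans (hs (y₀, h₀) ⟨hy₀, hh₀⟩ P hP)
  · obtain ⟨τ, hτ⟩ := G.exists_stageValue_eq n β P₀ y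
    rw [← hτ]
    -- Optimal continuations against `P₀` have best-reply vectors in `E`, so they are admissible
    -- deviations.
    exact hs (y, fun a => G.best n (τ a)) ⟨hy, fun a _ => hE _⟩ P₀ hP₀

/-! ### Player 1's guarantees and the primal value -/

/-- Against `cons2 y τ`, a best reply of player 1 induces some joint law of state and action. -/
theorem exists_best_cons2_eq (G : StochGame K A B) {p : K → ℝ} (hp : p ∈ stdSimplex ℝ K)
    (y : stdSimplex ℝ B) (τ : A → Strategy2 A B n) :
    ∃ P ∈ stdSimplex ℝ (K × A), (∀ k, ∑ a, P (k, a) = p k) ∧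
      p ⬝ᵥ G.best (n + 1) (cons2 y τ) = G.stagePayoff 0 P y.1 fun a => G.best n (τ a) := by
  classical
  have : ∀ k, ∃ a, G.best (n + 1) (cons2 y τ) k =
      G.M k a ⬝ᵥ y.1 + G.Q a k ⬝ᵥ G.best n (τ a) := by
    intro k
    obtain ⟨a, -, ha⟩ := Finset.exists_mem_eq_sup' Finset.univ_nonempty fun a =>
      G.M k a ⬝ᵥ y.1 + G.Q a k ⬝ᵥ G.best n (τ a)
    exact ⟨a, (G.best_cons2 y τ k).trans ha⟩
  choose g hg using this
  -- The joint law sits on the graph of a pure best reply `g`.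
  refine ⟨fun i => if i.2 = g i.1 then p i.1 else 0, ⟨fun i => ?_, ?_⟩, fun k => by simp, ?_⟩
  · dsimp only
    split_ifs
    exacts [hp.1 _, le_rfl]
  · simpa [Fintype.sum_prod_type] using hp.2
  · simp [stagePayoff, dotProduct, ite_mul, hg]

/-- If player 1 can guarantee `minVal` in the `n`-stage primal games, then it can do so also for
unnormalized initial laws. -/
theorem exists_guarantee_of_nonneg (G : StochGame K A B)
    (H : ∀ p ∈ stdSimplex ℝ K, ∃ σ : Strategy1 K A B n, ∀ τ, G.minVal n p ≤ G.primalPayoff n p σ τ)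
    {q : K → ℝ} (hq : 0 ≤ q) :
    ∃ σ : Strategy1 K A B n, ∀ τ, G.minVal n q ≤ G.primalPayoff n q σ τ := by
  have h0 : 0 ≤ ∑ k, q k := Finset.sum_nonneg fun k _ => hq k
  rcases h0.eq_or_lt with h | h
  · have : q = (0 : ℝ) • q := by
      rw [zero_smul]
      exact funext fun k =>
        (Finset.sum_eq_zero_iff_of_nonneg fun k _ => hq k).1 h.symm k (Finset.mem_univ k)
    rw [this]
    refine ⟨Classical.arbitrary _, fun τ => ?_⟩
    rw [primalPayoff_smul, minVal_smul _ le_rfl, zero_mul, zero_mul]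
  · obtain ⟨σ, hσ⟩ := H ((∑ k, q k)⁻¹ • q)
      ⟨fun k => mul_nonneg (inv_nonneg.2 h0) (hq k), by
        simp [← Finset.mul_sum, inv_mul_cancel₀ h.ne']⟩
    refine ⟨σ, fun τ => le_of_mul_le_mul_left ?_ (inv_pos.2 h)⟩
    rw [← primalPayoff_smul, ← minVal_smul _ (inv_nonneg.2 h0)]
    exact hσ τ

/-- Player 1 can realize any joint law of state and action at the first stage and then play
optimally for the posterior. -/
theorem exists_guarantee_succ (G : StochGame K A B)
    (H : ∀ p ∈ stdSimplex ℝ K, ∃ σ : Strategy1 K A B n, ∀ τ, G.minVal n p ≤ G.primalPayoff n p σ τ)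
    {P : K × A → ℝ} (hP : ∀ i, 0 ≤ P i) {p : K → ℝ} (hp : ∀ k, ∑ a, P (k, a) = p k) :
    ∃ σ : Strategy1 K A B (n + 1), ∀ τ,
      G.stageValue n 0 P (head2 τ).1 ≤ G.primalPayoff (n + 1) p σ τ := by
  have hx : ∀ k, ∃ x : stdSimplex ℝ A, ∀ a, p k * x.1 a = P (k, a) := by
    intro k
    have hpk : 0 ≤ p k := hp k ▸ Finset.sum_nonneg fun a _ => hP _
    rcases hpk.eq_or_lt with h | h
    -- In a state of probability zero any action will do.
    · refine ⟨Classical.arbitrary _, fun a => ?_⟩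
      rw [← h, zero_mul]
      exact ((Finset.sum_eq_zero_iff_of_nonneg fun a _ => hP (k, a)).1
        ((hp k).trans h.symm) a (Finset.mem_univ a)).symm
    · refine ⟨⟨fun a => P (k, a) / p k, fun a => div_nonneg (hP _) hpk, ?_⟩,
        fun a => mul_div_cancel₀ _ h.ne'⟩
      rw [← Finset.sum_div, hp, div_self h.ne']
  choose x hx using hx
  have hq : ∀ a, 0 ≤ (fun k => P (k, a)) ᵥ* G.Q a := fun a k' =>
    Finset.sum_nonneg fun k _ => mul_nonneg (hP _) ((G.Q_mem a k).1 k')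
  choose σ hσ using fun a => G.exists_guarantee_of_nonneg H (hq a)
  -- The continuation may forget the first state: `σ a` is good against the next-state law given
  -- `a`, and `b` carries no information about it.
  refine ⟨cons1 x σ, fun τ => ?_⟩
  have e : G.primalPayoff (n + 1) p (cons1 x σ) τ =
      (∑ k, ∑ a, P (k, a) * ((0 : K → ℝ) k + G.M k a ⬝ᵥ (head2 τ).1)) +
        ∑ a, ∑ b, (head2 τ).1 b *
          G.primalPayoff n ((fun k => P (k, a)) ᵥ* G.Q a) (σ a) (tail2 τ a b) := by
    have e2 : ∀ a, ∑ b, (head2 τ).1 b *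
        G.primalPayoff n ((fun k => P (k, a)) ᵥ* G.Q a) (σ a) (tail2 τ a b) =
        ∑ k, P (k, a) * ∑ b, (head2 τ).1 b * G.primalPayoff n (G.Q a k) (σ a) (tail2 τ a b) := by
      intro a
      simp_rw [primalPayoff_vecMul, Finset.mul_sum]
      rw [Finset.sum_comm]
      simp_rw [mul_left_comm]
    rw [primalPayoff_succ, Finset.sum_congr rfl fun a _ => e2 a, Finset.sum_comm (γ := A),
      ← Finset.sum_add_distrib]
    refine Finset.sum_congr rfl fun k _ => ?_
    rw [Finset.mul_sum, ← Finset.sum_add_distrib]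
    refine Finset.sum_congr rfl fun a _ => ?_
    rw [← mul_assoc, head1_cons1, hx, ← mul_add, Pi.zero_apply, zero_add, dotProduct,
      ← Finset.sum_add_distrib]
    refine congrArg _ (Finset.sum_congr rfl fun b _ => ?_)
    rw [tail1_cons1, mul_add, mul_comm (G.M k a b)]
  rw [e, stageValue]
  refine add_le_add_right (Finset.sum_le_sum fun a _ => ?_) _
  calc _ = ∑ b, (head2 τ).1 b * G.minVal n ((fun k => P (k, a)) ᵥ* G.Q a) := by
        rw [← Finset.sum_mul, (head2 τ).2.2, one_mul]
    _ ≤ _ := Finset.sum_le_sum fun b _ =>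
        mul_le_mul_of_nonneg_left (hσ a _) ((head2 τ).2.1 b)

theorem exists_primal_guarantee (G : StochGame K A B) (n : ℕ) :
    ∀ p ∈ stdSimplex ℝ K, ∃ σ : Strategy1 K A B n, ∀ τ,
      G.minVal n p ≤ G.primalPayoff n p σ τ := by
  classical
  induction n with
  | zero =>
    intro p _
    refine ⟨Classical.arbitrary _, fun τ => (G.minVal_le p τ).trans ?_⟩
    simp [primalPayoff_zero, best, dotProduct]
  | succ n ih =>
    intro p hp
    have hcont : IsClosed {P : K × A → ℝ | ∀ k, ∑ a, P (k, a) = p k} := by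
      simp only [Set.ofPred_forall]
      exact isClosed_iInter fun k => isClosed_eq (by fun_prop) continuous_const
    have hconv : Convex ℝ {P : K × A → ℝ | ∀ k, ∑ a, P (k, a) = p k} := by
      intro P hP P' hP' s t _ _ hst k
      simp only [Pi.add_apply, Pi.smul_apply, smul_eq_mul, Finset.sum_add_distrib,
        ← Finset.mul_sum, hP k, hP' k, ← add_mul, hst, one_mul]
    obtain ⟨P', hP', hP'm, -⟩ := G.exists_best_cons2_eq hp (Classical.arbitrary _)
      (Classical.arbitrary (A → Strategy2 A B n))
    -- Player 1 cannot alter the initial law here, so only joint laws with state marginal `p`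
    -- compete.
    obtain ⟨P₀, hP₀, y₀, hy₀, τ₀, c, h1, h2⟩ := G.exists_saddle n 0
      (X := stdSimplex ℝ (K × A) ∩ {P | ∀ k, ∑ a, P (k, a) = p k}) Set.inter_subset_left
      ((convex_stdSimplex ℝ _).inter hconv) ((isCompact_stdSimplex ℝ _).inter_right hcont)
      ⟨P', hP', hP'm⟩ (convex_stdSimplex ℝ B) (isCompact_stdSimplex ℝ B)
      ⟨_, (Classical.arbitrary (stdSimplex ℝ B)).2⟩
    obtain ⟨σ, hσ⟩ := G.exists_guarantee_succ ih hP₀.1.1 hP₀.2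
    refine ⟨σ, fun τ => ?_⟩
    obtain ⟨P, hP, hPm, e⟩ := G.exists_best_cons2_eq hp ⟨y₀, hy₀⟩ τ₀
    exact ((G.minVal_le p (cons2 ⟨y₀, hy₀⟩ τ₀)).trans (e.le.trans (h1 P ⟨hP, hPm⟩))).trans
      ((h2 _ (head2 τ).2).trans (hσ τ))

theorem isGameValue_primal (G : StochGame K A B) (n : ℕ) {p : K → ℝ} (hp : p ∈ stdSimplex ℝ K) :
    IsGameValue (G.primalPayoff n p) (G.minVal n p) := by
  obtain ⟨σ, hσ⟩ := G.exists_primal_guarantee n p hp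
  obtain ⟨τ, hτ⟩ := G.exists_minVal_eq n p
  refine isGameValue_of_saddle (x₀ := σ) (y₀ := τ) (fun τ => ?_) (fun σ => ?_)
    (fun σ => (G.primalPayoff_le_best hp.1 σ τ).trans hτ.le) hσ
  · exact G.continuous_primalPayoff continuous_const continuous_id continuous_const
  · exact G.continuous_primalPayoff continuous_const continuous_const continuous_id

theorem primalValue_eq_minVal (G : StochGame K A B) (n : ℕ) {p : K → ℝ}
    (hp : p ∈ stdSimplex ℝ K) : G.primalValue n p = G.minVal n p :=
  (G.isGameValue_primal n hp).1.eq_iSup_iInf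

/-- Positive homogeneity of `minVal` absorbs the normalization; for an action of probability zero
both sides vanish. -/
theorem actionProb_mul_primalValue (G : StochGame K A B) (n : ℕ) {P : K × A → ℝ}
    (hP : ∀ i, 0 ≤ P i) (a : A) :
    actionProb P a * G.primalValue n (posterior P a ᵥ* G.Q a) =
      G.minVal n ((fun k => P (k, a)) ᵥ* G.Q a) := by
  have h0 : 0 ≤ actionProb P a := Finset.sum_nonneg fun k _ => hP _
  have e : (fun k => P (k, a)) = actionProb P a • posterior P a := by
    funext k
    rcases h0.eq_or_lt with h | h
    · have := (Finset.sum_eq_zero_iff_of_nonneg fun k _ => hP (k, a)).1 h.symm k (Finset.mem_univ k)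
      simp [this, ← h]
    · exact (mul_div_cancel₀ _ h.ne').symm
  rw [e, Matrix.smul_vecMul, minVal_smul _ h0]
  rcases h0.eq_or_lt with h | h
  · rw [← h, zero_mul, zero_mul]
  · rw [primalValue_eq_minVal]
    have hpost : ∑ k, posterior P a k = 1 := by
      simp only [posterior, ← Finset.sum_div]
      exact div_self h.ne'
    refine ⟨fun k' => Finset.sum_nonneg fun k _ =>
      mul_nonneg (div_nonneg (hP _) h0) ((G.Q_mem a k).1 k'), ?_⟩
    simp only [Matrix.vecMul, dotProduct]
    rw [Finset.sum_comm]
    simp_rw [← Finset.mul_sum, (G.Q_mem a _).2, mul_one]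
    exact hpost

end StochGame

/-! ### The dual game and its one-stage formula -/

theorem mainTheorem9 {K A B : Type*} [Fintype K] [Fintype A] [Fintype B]
    [Nonempty K] [Nonempty A] [Nonempty B] (G : StochGame K A B) (n : ℕ) (α : K → ℝ) :
    (∀ p ∈ stdSimplex ℝ K, IsGameValue (G.primalPayoff n p) (G.primalValue n p)) ∧
    IsGameValue (G.dualPayoff (n + 1) α) (G.dualValue (n + 1) α) ∧
    IsMinMax
      (fun (P : stdSimplex ℝ (K × A)) (y : stdSimplex ℝ B) =>
        (∑ k, ∑ a, P.1 (k, a) * (α k + G.M k a ⬝ᵥ y.1)) +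
          ∑ a, actionProb P.1 a * G.primalValue n (posterior P.1 a ᵥ* G.Q a))
      (G.dualValue (n + 1) α) := by
  classical
  -- Player 1 now chooses the initial law too, so the state marginal of `P` is unconstrained.
  obtain ⟨P₀, hP₀, y₀, hy₀, τ₀, c, h1, h2⟩ := G.exists_saddle n α subset_rfl
    (convex_stdSimplex ℝ (K × A)) (isCompact_stdSimplex ℝ _)
    ⟨_, (Classical.arbitrary (stdSimplex ℝ (K × A))).2⟩ (convex_stdSimplex ℝ B)
    (isCompact_stdSimplex ℝ B) ⟨_, (Classical.arbitrary (stdSimplex ℝ B)).2⟩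
  have hdual : IsGameValue (G.dualPayoff (n + 1) α) c := by
    obtain ⟨σ, hσ⟩ := G.exists_guarantee_succ (G.exists_primal_guarantee n) hP₀.1 fun _ => rfl
    have hp : (fun k => ∑ a, P₀ (k, a)) ∈ stdSimplex ℝ K :=
      ⟨fun k => Finset.sum_nonneg fun a _ => hP₀.1 _, by
        rw [← Fintype.sum_prod_type]; exact hP₀.2⟩
    refine isGameValue_of_saddle (x₀ := (⟨_, hp⟩, σ)) (y₀ := StochGame.cons2 ⟨y₀, hy₀⟩ τ₀)
      (fun τ => ?_) (fun s => ?_)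
      (fun s => ?_) (fun τ => ?_)
    · exact G.continuous_dualPayoff α continuous_id continuous_const
    · exact G.continuous_dualPayoff α continuous_const continuous_id
    · obtain ⟨P, hP, hPm, e⟩ := G.exists_best_cons2_eq s.1.2 ⟨y₀, hy₀⟩ τ₀
      refine le_trans ?_ (h1 P hP)
      rw [StochGame.dualPayoff_eq, StochGame.stagePayoff_eq_add, ← e, funext hPm]
      exact add_le_add_right (G.primalPayoff_le_best s.1.2.1 _ _) _
    · refine (h2 _ (StochGame.head2 τ).2).trans ?_
      rw [StochGame.dualPayoff_eq, StochGame.stageValue_eq_add]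
      exact add_le_add_right (hσ τ) _
  have hc : G.dualValue (n + 1) α = c := hdual.1.eq_iSup_iInf
  refine ⟨fun p hp => ?_, hc ▸ hdual, ?_⟩
  · rw [G.primalValue_eq_minVal n hp]
    exact G.isGameValue_primal n hp
  have hF : (fun (P : stdSimplex ℝ (K × A)) (y : stdSimplex ℝ B) =>
      (∑ k, ∑ a, P.1 (k, a) * (α k + G.M k a ⬝ᵥ y.1)) +
        ∑ a, actionProb P.1 a * G.primalValue n (posterior P.1 a ᵥ* G.Q a)) =
      fun P y => G.stageValue n α P.1 y.1 := by
    funext P y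
    simp only [G.actionProb_mul_primalValue n P.2.1, StochGame.stageValue]
  rw [hF, hc]
  have hmax : ∀ y : stdSimplex ℝ B, ∃ v, IsGreatest
      (Set.range fun P : stdSimplex ℝ (K × A) => G.stageValue n α P.1 y.1) v := by
    intro y
    -- With `y` frozen as a singleton, the saddle point gives a maximizer `P` without proving
    -- continuity of `stageValue`.
    obtain ⟨P, hP, y', rfl, τ, v, hv1, hv2⟩ := G.exists_saddle n α subset_rfl
      (convex_stdSimplex ℝ (K × A)) (isCompact_stdSimplex ℝ _) ⟨_, hP₀⟩
      (convex_singleton y.1) isCompact_singleton (Set.singleton_nonempty _)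
    have hle : ∀ P' : stdSimplex ℝ (K × A), G.stageValue n α P'.1 y.1 ≤ v :=
      fun P' => (G.stageValue_le α _ _ τ).trans (hv1 _ P'.2)
    refine ⟨v, ⟨⟨P, hP⟩, le_antisymm (hle _) (hv2 _ rfl)⟩, ?_⟩
    rintro _ ⟨P', rfl⟩
    exact hle P'
  choose v hv using hmax
  have hle : ∀ y : stdSimplex ℝ B, c ≤ v y := fun y =>
    (h2 y.1 y.2).trans ((hv y).2 ⟨⟨P₀, hP₀⟩, rfl⟩)
  refine ⟨v, hv, ⟨⟨y₀, hy₀⟩, le_antisymm ?_ (hle _)⟩, ?_⟩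
  · obtain ⟨P, hP⟩ := (hv ⟨y₀, hy₀⟩).1
    exact hP.ge.trans ((G.stageValue_le α _ _ τ₀).trans (h1 _ P.2))
  · rintro _ ⟨y, rfl⟩
    exact hle y
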